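/- Let $n\ge 2$ and $m,s\ge 0$ be integers, let $B^n=\{\boldsymbol z\in\mathbb C^n:|\boldsymbol z|<1\}$ be the open unit ball for the Euclidean norm $|\cdot|$, let $\partial B^n$ be the unit sphere, and let $\boldsymbol 1=(1,0,\dots,0)\in\partial B^n$. Let $\Phi:\mathbb C^n\to\mathbb C^m$ be a map whose components are polynomials in $z_1,\dots,z_n$ of total degree at most $s$, none of which vanishes at $\boldsymbol 1$. Let $F:B^n\to\mathbb C^m$ be a holomorphic map such that, for some $\varepsilon>0$, $|F(\boldsymbol w)|\le|\Phi(\boldsymbol w)|$ for all $\boldsymbol w\in\partial B^n$ with $|\boldsymbol w-\boldsymbol 1|<\varepsilon$, in the sense that $$\limsup_{B^n\ni \boldsymbol z\to \boldsymbol w}|F(\boldsymbol z)|\le|\Phi(\boldsymbol w)|$$ (if $F$ extends continuously to $\boldsymbol w$, this is the inequality for the extended value), and such that $$F(\boldsymbol z)=\Phi(\boldsymbol z)+o\big(|\boldsymbol z-\boldsymbol 1|^{2s+1}\big)\qquad\text{as } B^n\ni \boldsymbol z\to\boldsymbol 1 .$$ Then $F(\boldsymbol z)=\Phi(\boldsymbol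 z)$ for all $\boldsymbol z\in B^n$. -/

import Mathlib

open Filter Topology Asymptotics

/-- The point `𝟏 = (1, 0, …, 0)` of `ℂⁿ`. -/
noncomputable def basePoint (n : ℕ) : EuclideanSpace ℂ (Fin n) :=
  WithLp.toLp 2 fun i => if (i : ℕ) = 0 then 1 else 0

/-- The open Euclidean unit ball `Bⁿ` of `ℂⁿ`. -/
abbrev unitBall (n : ℕ) : Set (EuclideanSpace ℂ (Fin n)) :=
  Metric.ball 0 1

/-- The map `ℂⁿ → ℂᵐ` whose components are the polynomials `P 0, …, P (m - 1)`. -/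
noncomputable def polyMap {n m : ℕ} (P : Fin m → MvPolynomial (Fin n) ℂ)
    (z : EuclideanSpace ℂ (Fin n)) : EuclideanSpace ℂ (Fin m) :=
  WithLp.toLp 2 fun j => MvPolynomial.eval (fun i => z i) (P j)

/-- The inequality `|F(w)| ≤ c` at a boundary point `w` of the unit ball, for a map `F` given
inside the ball: `limsup |F(z)| ≤ c` as `z → w` from within the ball. The upper limit is taken in
`[0, ∞]`. If `F` extends continuously to `w`, this says that the norm of the extension at `w` is
at most `c`. -/
def BoundaryNormLE {n m : ℕ} (F : EuclideanSpace ℂ (Fin n) → EuclideanSpace ℂ (Fin m))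
    (w : EuclideanSpace ℂ (Fin n)) (c : ℝ) : Prop :=
  limsup (fun z => ‖F z‖ₑ) (𝓝[unitBall n] w) ≤ ENNReal.ofReal c

/-!
The uniqueness theorem reduces to the unit disc. A complex line through `𝟏` that is nearly tangent
to the sphere meets the ball in a small disc with `𝟏` on its boundary, and the whole boundary circle
lies where `|F| ≤ |Φ|` is known. In dimension at least two, these discs cover a nonempty open
subset of the ball, so equality on each of them gives equality everywhere, by the identity theorem
(`eq_polyMap_of_norm_inner_lt`, `exists_mem_unitBall_norm_inner_lt`,
`eqOn_zero_of_convex_of_eventuallyEq_zero`).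

On the disc (`eq_polyCurve_of_isLittleO`), let `Φ` be a polynomial curve of degree at most `s` and
`f` holomorphic with `|f| ≤ |Φ|` on the circle. There `conj Φ(ζ) = conj Φ(1 / conj ζ)`, and
`ζ ^ s * conj Φ(1 / conj ζ)` is a polynomial, while `|1 - ζ| ^ 2 = -(1 - ζ) ^ 2 / ζ`. Hence
`⟪Φ, Φ - f⟫ / |1 - ζ| ^ (2 * s)` on the circle is the boundary value of the *holomorphic* function
`H = (-1) ^ s * (1 - ζ) ^ (-2 * s) * ζ ^ s * ⟪Φ(1 / conj ζ), Φ(ζ) - f(ζ)⟫` (`pairingQuotient`):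
dividing by `|1 - ζ| ^ (2 * s)` supplies exactly the factor `ζ ^ s` that cancels the pole created at
the origin by the reflection. By Cauchy–Schwarz, `Re H ≥ 0` on the circle, except perhaps at `1`;
there `f - Φ = o(|ζ - 1| ^ (2 * s + 1))` gives `H = o(|ζ - 1|)`, so that `Re H ≥ 0` on the disc by
the maximum principle. A function with nonnegative real part cannot vanish to order greater than one
at a boundary point unless it is zero (`eq_zero_of_re_nonneg_of_isLittleO`, from the Schwarz–Pick
inequality), so `H = 0`. Thus `⟪Φ, f⟫ = |Φ| ^ 2` on the circle, and together with `|f| ≤ |Φ|` this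
forces `f = Φ` there, hence on the disc.
-/

/-! ### The maximum principle on the disc with boundary values in the limit -/

/-- The maximum modulus principle for a map given only inside the disc, its boundary bound being an
upper limit. -/
theorem norm_le_of_eventually_norm_le {E : Type*} [NormedAddCommGroup E] [NormedSpace ℂ E]
    {f : ℂ → E} {C : ℝ} (hf : DifferentiableOn ℂ f (Metric.ball 0 1))
    (hb : ∀ w ∈ Metric.sphere (0 : ℂ) 1, ∀ C' > C, ∀ᶠ ζ in 𝓝[Metric.ball 0 1] w, ‖f ζ‖ ≤ C')
    {z : ℂ} (hz : z ∈ Metric.ball (0 : ℂ) 1) : ‖f z‖ ≤ C := by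
  refine le_of_forall_gt_imp_ge_of_dense fun C' hC' => ?_
  have hS : {ζ : ℂ | ζ ∈ Metric.ball (0 : ℂ) 1 → ‖f ζ‖ ≤ C'} ∈ 𝓝ˢ (Metric.sphere (0 : ℂ) 1) :=
    eventually_nhdsSet_iff_forall.2 fun w hw => eventually_nhdsWithin_iff.1 (hb w hw C' hC')
  obtain ⟨U, ⟨hU, hSU⟩, hUs⟩ := (hasBasis_nhdsSet _).mem_iff.1 hS
  obtain ⟨δ, hδ, hδU⟩ := (isCompact_sphere (0 : ℂ) 1).exists_thickening_subset_open hU hSU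
  rw [mem_ball_zero_iff] at hz
  obtain ⟨r, hr, hr1⟩ := exists_between (max_lt hz (by linarith : 1 - δ < 1))
  obtain ⟨hzr, hδr⟩ := max_lt_iff.1 hr
  have hr0 : 0 < r := (norm_nonneg z).trans_lt hzr
  refine Complex.norm_le_of_forall_mem_frontier_norm_le (U := Metric.ball (0 : ℂ) r)
    Metric.isBounded_ball
    (hf.diffContOnCl_ball (Metric.closedBall_subset_ball hr1)) (fun ζ hζ => ?_)
    (subset_closure (mem_ball_zero_iff.2 hzr))
  have hζr : ‖ζ‖ = r := mem_sphere_zero_iff_norm.1 (Metric.frontier_ball_subset_sphere hζ)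
  refine hUs (hδU (Metric.mem_thickening_iff.2 ⟨((r⁻¹ : ℝ) : ℂ) * ζ, ?_, ?_⟩))
    (mem_ball_zero_iff.2 (hζr.trans_lt hr1))
  · simp [hζr, abs_of_pos hr0, hr0.ne']
  · have : ζ - ((r⁻¹ : ℝ) : ℂ) * ζ = ((1 - r⁻¹ : ℝ) : ℂ) * ζ := by push_cast; ring
    rw [dist_eq_norm, this, norm_mul, hζr, Complex.norm_real, Real.norm_eq_abs,
      abs_of_nonpos (by rw [sub_nonpos]; exact (one_le_inv₀ hr0).2 hr1.le)]
    field_simp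
    linarith

theorem re_nonneg_of_eventually_neg_le_re {H : ℂ → ℂ}
    (hH : DifferentiableOn ℂ H (Metric.ball 0 1))
    (hb : ∀ w ∈ Metric.sphere (0 : ℂ) 1, ∀ η > 0, ∀ᶠ ζ in 𝓝[Metric.ball 0 1] w, -η ≤ (H ζ).re)
    {z : ℂ} (hz : z ∈ Metric.ball (0 : ℂ) 1) : 0 ≤ (H z).re := by
  have h : ‖Complex.exp (-H z)‖ ≤ 1 := by
    refine norm_le_of_eventually_norm_le (f := fun ζ => Complex.exp (-H ζ)) hH.neg.cexp
      (fun w hw C' hC' => ?_) hz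
    filter_upwards [hb w hw (Real.log C') (Real.log_pos hC')] with ζ hζ
    rw [Complex.norm_exp, Complex.neg_re, ← Real.le_log_iff_exp_le (by linarith)]
    linarith
  rw [Complex.norm_exp, Complex.neg_re, Real.exp_le_one_iff] at h
  linarith

/-! ### A boundary uniqueness theorem for functions with nonnegative real part -/

/-- The Schwarz–Pick inequality for functions into the right half-plane, the Schwarz lemma applied
to the Cayley transform that sends `H 0` to `0`. -/
theorem schwarzPick_re_nonneg {H : ℂ → ℂ} (hH : DifferentiableOn ℂ H (Metric.ball 0 1))
    (hre : ∀ z ∈ Metric.ball (0 : ℂ) 1, 0 ≤ (H z).re) {z : ℂ} (hz : z ∈ Metric.ball (0 : ℂ) 1) :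
    (1 - ‖z‖ ^ 2) * ‖H z + (starRingEnd ℂ) (H 0)‖ ^ 2 ≤ 4 * (H z).re * (H 0).re := by
  have key : ∀ a b : ℂ, ‖a + (starRingEnd ℂ) b‖ ^ 2 - ‖a - b‖ ^ 2 = 4 * a.re * b.re := by
    intro a b
    rw [Complex.sq_norm, Complex.sq_norm, Complex.normSq_apply, Complex.normSq_apply]
    simp
    ring
  -- Adding `η > 0` keeps the denominator of the Cayley transform away from zero.
  have hη : ∀ η : ℝ, 0 < η → (1 - ‖z‖ ^ 2) * ‖(H z + η) + (starRingEnd ℂ) (H 0 + η)‖ ^ 2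
      ≤ 4 * (H z + η).re * (H 0 + η).re := by
    intro η hη
    have h0 : (0 : ℂ) ∈ Metric.ball (0 : ℂ) 1 := by simp
    have hden : ∀ ζ ∈ Metric.ball (0 : ℂ) 1, H ζ + η + (starRingEnd ℂ) (H 0 + η) ≠ 0 := by
      intro ζ hζ h
      have := congrArg Complex.re h
      simp at this
      linarith [hre ζ hζ, hre 0 h0]
    have hle : ∀ ζ ∈ Metric.ball (0 : ℂ) 1,
        ‖(H ζ + η) - (H 0 + η)‖ ≤ ‖H ζ + η + (starRingEnd ℂ) (H 0 + η)‖ := by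
      intro ζ hζ
      refine (sq_le_sq₀ (norm_nonneg _) (norm_nonneg _)).1 ?_
      have h1 := key (H ζ + η) (H 0 + η)
      have h2 : 0 ≤ 4 * (H ζ + η).re * (H 0 + η).re := by
        have := hre ζ hζ
        have := hre 0 h0
        simp only [Complex.add_re, Complex.ofReal_re]
        positivity
      linarith
    have hsch := Complex.norm_le_norm_of_mapsTo_ball
      (f := fun ζ => ((H ζ + η) - (H 0 + η)) / (H ζ + η + (starRingEnd ℂ) (H 0 + η)))
      (R := 1) (z := z) (((hH.add_const _).sub_const _).div ((hH.add_const _).add_const _) hden)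
      (fun ζ hζ => by
        rw [mem_closedBall_zero_iff, norm_div]
        exact div_le_one_of_le₀ (hle ζ hζ) (norm_nonneg _))
      (by simp) (mem_ball_zero_iff.1 hz)
    rw [norm_div, div_le_iff₀ (norm_pos_iff.2 (hden z hz))] at hsch
    have h1 := key (H z + η) (H 0 + η)
    have h2 := pow_le_pow_left₀ (norm_nonneg _) hsch 2
    rw [mul_pow] at h2
    linarith
  have hl : Tendsto (fun η : ℝ => (1 - ‖z‖ ^ 2) * ‖(H z + η) + (starRingEnd ℂ) (H 0 + η)‖ ^ 2)
      (𝓝[>] 0) (𝓝 ((1 - ‖z‖ ^ 2) * ‖H z + (starRingEnd ℂ) (H 0)‖ ^ 2)) := by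
    refine (Continuous.tendsto' ?_ 0 _ (by simp)).mono_left nhdsWithin_le_nhds
    fun_prop
  have hr : Tendsto (fun η : ℝ => 4 * (H z + η).re * (H 0 + η).re)
      (𝓝[>] 0) (𝓝 (4 * (H z).re * (H 0).re)) := by
    refine (Continuous.tendsto' ?_ 0 _ (by simp)).mono_left nhdsWithin_le_nhds
    fun_prop
  exact le_of_tendsto_of_tendsto hl hr (eventually_nhdsWithin_of_forall hη)

theorem tendsto_ofReal_nhdsWithin_ball_one :
    Tendsto (fun r : ℝ => (r : ℂ)) (𝓝[<] 1) (𝓝[Metric.ball 0 1] 1) := by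
  refine tendsto_nhdsWithin_iff.2
    ⟨(Complex.continuous_ofReal.tendsto' 1 1 (by simp)).mono_left nhdsWithin_le_nhds, ?_⟩
  filter_upwards [Ioo_mem_nhdsLT (zero_lt_one (α := ℝ))] with r hr
  simpa [abs_of_pos hr.1] using hr.2

/-- A Hopf lemma: a holomorphic function on the disc with nonnegative real part cannot vanish to
order greater than one at a boundary point without vanishing identically. -/
theorem eq_zero_of_re_nonneg_of_isLittleO {H : ℂ → ℂ}
    (hH : DifferentiableOn ℂ H (Metric.ball 0 1))
    (hre : ∀ z ∈ Metric.ball (0 : ℂ) 1, 0 ≤ (H z).re)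
    (ho : H =o[𝓝[Metric.ball 0 1] 1] fun z => z - 1)
    {z : ℂ} (hz : z ∈ Metric.ball (0 : ℂ) 1) : H z = 0 := by
  have hr := ho.comp_tendsto tendsto_ofReal_nhdsWithin_ball_one
  have h1 : Tendsto (fun r : ℝ => ‖H r‖ / (1 - r)) (𝓝[<] 1) (𝓝 0) := by
    refine hr.norm_norm.tendsto_div_nhds_zero.congr' ?_
    filter_upwards [self_mem_nhdsWithin] with r (hr : r < 1)
    have : (r : ℂ) - 1 = ((r - 1 : ℝ) : ℂ) := by push_cast; rfl
    simp only [Function.comp_apply, this, Complex.norm_real, Real.norm_eq_abs]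
    rw [abs_of_neg (by linarith), neg_sub]
  have h0 : Tendsto (fun r : ℝ => H r) (𝓝[<] 1) (𝓝 0) := by
    refine hr.trans_tendsto ?_
    exact (Continuous.tendsto' (by fun_prop) 1 _ (by simp)).mono_left nhdsWithin_le_nhds
  have hH0 : H 0 = 0 := by
    have hl : Tendsto (fun r : ℝ => ‖H r + (starRingEnd ℂ) (H 0)‖ ^ 2) (𝓝[<] 1)
        (𝓝 (‖(0 : ℂ) + (starRingEnd ℂ) (H 0)‖ ^ 2)) := ((h0.add_const _).norm.pow 2)
    have hR : Tendsto (fun r : ℝ => 4 * (‖H r‖ / (1 - r)) * ‖H 0‖) (𝓝[<] 1)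
        (𝓝 (4 * 0 * ‖H 0‖)) := (h1.const_mul 4).mul_const _
    have hle := le_of_tendsto_of_tendsto hl hR (by
      filter_upwards [Ioo_mem_nhdsLT (zero_lt_one (α := ℝ))] with r hr
      have hrb : (r : ℂ) ∈ Metric.ball (0 : ℂ) 1 := by simpa [abs_of_pos hr.1] using hr.2
      have hsp := schwarzPick_re_nonneg hH hre hrb
      have hb : 4 * (H r).re * (H 0).re ≤ 4 * ‖H r‖ * ‖H 0‖ := by
        have := hre r hrb
        have := hre 0 (by simp)
        gcongr <;> exact Complex.re_le_norm _
      have hr1 : 0 < 1 - r := by linarith [hr.2]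
      have e : 4 * (‖H r‖ / (1 - r)) * ‖H 0‖ = 4 * ‖H r‖ * ‖H 0‖ / (1 - r) := by ring
      rw [e, le_div_iff₀ hr1]
      rw [Complex.norm_real, Real.norm_eq_abs, sq_abs] at hsp
      have : (1 - r) * ‖H r + (starRingEnd ℂ) (H 0)‖ ^ 2
          ≤ (1 - r ^ 2) * ‖H r + (starRingEnd ℂ) (H 0)‖ ^ 2 := by
        gcongr
        nlinarith [hr.1, hr.2]
      linarith)
    simpa using hle
  have hsp := schwarzPick_re_nonneg hH hre hz
  have hz1 : ‖z‖ < 1 := mem_ball_zero_iff.1 hz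
  have hpos : 0 < 1 - ‖z‖ ^ 2 := by nlinarith [norm_nonneg z]
  simp only [hH0, map_zero, add_zero, Complex.zero_re, mul_zero] at hsp
  have := nonpos_of_mul_nonpos_right hsp hpos
  simpa using this

/-! ### The uniqueness theorem on the disc -/

/-- The map `ℂ → ℂᵐ` whose components are the one-variable polynomials `p 0, …, p (m - 1)`. -/
noncomputable def polyCurve {m : ℕ} (p : Fin m → Polynomial ℂ) (ζ : ℂ) :
    EuclideanSpace ℂ (Fin m) :=
  WithLp.toLp 2 fun j => (p j).eval ζ

theorem continuous_polyCurve {m : ℕ} (p : Fin m → Polynomial ℂ) : Continuous (polyCurve p) :=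
  (PiLp.continuous_toLp 2 _).comp (continuous_pi fun j => (p j).continuous)

theorem differentiable_polyCurve {m : ℕ} (p : Fin m → Polynomial ℂ) :
    Differentiable ℂ (polyCurve p) :=
  differentiable_euclidean.2 fun j => (p j).differentiable

/-- The polynomial `ζ ^ s * conj (p (1 / conj ζ))`, which agrees with `ζ ^ s * conj (p ζ)` on the
unit circle. -/
theorem eval_reflect_map_conj {s : ℕ} {p : Polynomial ℂ} (hp : p.natDegree ≤ s) {ζ : ℂ}
    (hζ : ζ ≠ 0) :
    ((p.map (starRingEnd ℂ)).reflect s).eval ζ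
      = ζ ^ s * (starRingEnd ℂ) (p.eval ((starRingEnd ℂ) ζ)⁻¹) := by
  let _ : Invertible ζ⁻¹ := invertibleOfNonzero (inv_ne_zero hζ)
  have h := Polynomial.eval₂_reflect_mul_pow (RingHom.id ℂ) ζ⁻¹ s (p.map (starRingEnd ℂ))
    (Polynomial.natDegree_map_le.trans hp)
  simp only [invOf_eq_inv, inv_inv, Polynomial.eval₂_id] at h
  have h2 : (p.map (starRingEnd ℂ)).eval ζ⁻¹
      = (starRingEnd ℂ) (p.eval ((starRingEnd ℂ) ζ)⁻¹) := by
    rw [← Polynomial.eval_map_apply]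
    simp
  rw [← h2, ← h, mul_left_comm, ← mul_pow, mul_inv_cancel₀ hζ, one_pow, mul_one]

/-- On the unit circle the Koebe-type function `-ζ / (1 - ζ) ^ 2` is positive. -/
theorem neg_div_one_sub_sq_eq {w : ℂ} (hw : ‖w‖ = 1) (hw1 : w ≠ 1) :
    -w / (1 - w) ^ 2 = (((‖1 - w‖ ^ 2)⁻¹ : ℝ) : ℂ) := by
  have h1 : (1 - w) ≠ 0 := sub_ne_zero.2 hw1.symm
  have hw0 : w ≠ 0 := norm_ne_zero_iff.1 (by simp [hw])
  have h2 : ((‖1 - w‖ ^ 2 : ℝ) : ℂ) = (1 - w) * (1 - w⁻¹) := by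
    rw [Complex.inv_eq_conj hw, Complex.ofReal_pow, ← Complex.mul_conj', map_sub, map_one]
  rw [Complex.ofReal_inv, h2]
  have h3 : w - 1 ≠ 0 := sub_ne_zero.2 hw1
  have h4 : 1 - w⁻¹ ≠ 0 := by
    rw [sub_ne_zero]
    exact fun h => hw1 (by simpa using h.symm)
  field_simp
  ring

theorem tendsto_polyCurve_inv_conj {m : ℕ} (p : Fin m → Polynomial ℂ) {w : ℂ} (hw : ‖w‖ = 1)
    (l : Filter ℂ) (hl : l ≤ 𝓝 w) :
    Tendsto (fun ζ => polyCurve p ((starRingEnd ℂ) ζ)⁻¹) l (𝓝 (polyCurve p w)) := by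
  have hw0 : (starRingEnd ℂ) w ≠ 0 := by
    rw [Ne, map_eq_zero, ← norm_eq_zero, hw]
    exact one_ne_zero
  have h : ((starRingEnd ℂ) w)⁻¹ = w := by rw [← map_inv₀, Complex.inv_eq_conj hw, Complex.conj_conj]
  have := ((Complex.continuous_conj.tendsto w).inv₀ hw0)
  rw [h] at this
  exact (((continuous_polyCurve p).tendsto w).comp this).mono_left hl

/-- The holomorphic function on the disc that extends
`⟪Φ, Φ - f⟫ / |1 - ζ| ^ (2 * s)` from the unit circle, where `Φ` is the polynomial curve with
components `p` of degree at most `s`. The sign comes from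
`|1 - ζ| ^ 2 = -(1 - ζ) ^ 2 / ζ` on the circle. -/
noncomputable def pairingQuotient {m : ℕ} (s : ℕ) (p : Fin m → Polynomial ℂ)
    (f : ℂ → EuclideanSpace ℂ (Fin m)) (ζ : ℂ) : ℂ :=
  (-1) ^ s / (1 - ζ) ^ (2 * s) *
    ∑ j, (((p j).map (starRingEnd ℂ)).reflect s).eval ζ * (polyCurve p ζ - f ζ) j

section Disc

variable {m s : ℕ} {p : Fin m → Polynomial ℂ} {f : ℂ → EuclideanSpace ℂ (Fin m)}

theorem pairingQuotient_eq_inner (hp : ∀ j, (p j).natDegree ≤ s) {ζ : ℂ} (hζ : ζ ≠ 0) :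
    pairingQuotient s p f ζ = (-ζ / (1 - ζ) ^ 2) ^ s *
      inner ℂ (polyCurve p ((starRingEnd ℂ) ζ)⁻¹) (polyCurve p ζ - f ζ) := by
  rw [pairingQuotient, PiLp.inner_apply, Finset.mul_sum, Finset.mul_sum]
  refine Finset.sum_congr rfl fun j _ => ?_
  rw [eval_reflect_map_conj (hp j) hζ, RCLike.inner_apply, div_pow, neg_pow ζ, ← pow_mul]
  simp only [polyCurve]
  ring

theorem differentiableOn_pairingQuotient (hf : DifferentiableOn ℂ f (Metric.ball 0 1)) :
    DifferentiableOn ℂ (pairingQuotient s p f) (Metric.ball 0 1) := by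
  unfold pairingQuotient
  have h1 : DifferentiableOn ℂ (fun ζ : ℂ => (-1) ^ s / (1 - ζ) ^ (2 * s)) (Metric.ball 0 1) := by
    refine DifferentiableOn.div (by fun_prop) (by fun_prop) fun ζ hζ => pow_ne_zero _ ?_
    rw [sub_ne_zero]
    rintro rfl
    simp at hζ
  refine h1.mul (DifferentiableOn.fun_sum fun j _ => ?_)
  refine (Polynomial.differentiable _).differentiableOn.mul ?_
  exact differentiableOn_euclidean.1 ((differentiable_polyCurve p).differentiableOn.sub hf) j

theorem isLittleO_pairingQuotient
    (ho : (fun ζ => f ζ - polyCurve p ζ)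
      =o[𝓝[Metric.ball 0 1] 1] fun ζ => ‖ζ - 1‖ ^ (2 * s + 1)) :
    pairingQuotient s p f =o[𝓝[Metric.ball 0 1] 1] fun ζ => ζ - 1 := by
  have h1 : (fun ζ => ∑ j, (((p j).map (starRingEnd ℂ)).reflect s).eval ζ * (polyCurve p ζ - f ζ) j)
      =o[𝓝[Metric.ball 0 1] 1] fun ζ => ‖ζ - 1‖ ^ (2 * s + 1) := by
    refine IsLittleO.fun_sum fun j _ => ?_
    have hb : (fun ζ => (((p j).map (starRingEnd ℂ)).reflect s).eval ζ)
        =O[𝓝[Metric.ball 0 1] 1] fun _ => (1 : ℝ) :=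
      (((Polynomial.continuous _).tendsto 1).mono_left nhdsWithin_le_nhds).isBigO_one ℝ
    have hj : (fun ζ => (polyCurve p ζ - f ζ) j) =o[𝓝[Metric.ball 0 1] 1]
        fun ζ => ‖ζ - 1‖ ^ (2 * s + 1) := by
      refine IsBigO.trans_isLittleO (IsBigO.of_bound 1 (Eventually.of_forall fun ζ => ?_)) ho
      rw [one_mul, norm_sub_rev]
      exact PiLp.norm_apply_le _ j
    simpa using hb.mul_isLittleO hj
  have h2 := (isBigO_refl (fun ζ : ℂ => (-1) ^ s / (1 - ζ) ^ (2 * s))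
    (𝓝[Metric.ball 0 1] 1)).norm_right.mul_isLittleO h1
  refine h2.trans_isBigO (IsBigO.of_bound 1 ?_)
  filter_upwards [self_mem_nhdsWithin] with ζ hζ
  have h3 : ‖1 - ζ‖ ≠ 0 := by
    rw [norm_ne_zero_iff, sub_ne_zero]
    rintro rfl
    simp at hζ
  rw [norm_mul, norm_norm, norm_div, norm_pow, norm_pow, norm_neg, norm_one, one_pow, norm_pow,
    norm_norm, norm_sub_rev ζ 1, pow_succ, one_mul]
  field_simp
  rfl

/-- `Re ⟪Φ, Φ - f⟫ ≥ 0` on the unit circle, by the Cauchy–Schwarz inequality. -/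
theorem eventually_neg_le_re_pairingQuotient (hp : ∀ j, (p j).natDegree ≤ s) {w : ℂ}
    (hw : ‖w‖ = 1) (hw1 : w ≠ 1)
    (hb : ∀ η > 0, ∀ᶠ ζ in 𝓝[Metric.ball 0 1] w, ‖f ζ‖ ≤ ‖polyCurve p w‖ + η)
    {η : ℝ} (hη : 0 < η) :
    ∀ᶠ ζ in 𝓝[Metric.ball 0 1] w, -η ≤ (pairingQuotient s p f ζ).re := by
  set l := 𝓝[Metric.ball (0 : ℂ) 1] w
  have hl : l ≤ 𝓝 w := nhdsWithin_le_nhds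
  have hw0 : w ≠ 0 := norm_ne_zero_iff.1 (by simp [hw])
  set κ : ℝ := ((‖1 - w‖ ^ 2)⁻¹) ^ s with hκ
  have hκ0 : 0 ≤ κ := by positivity
  set a : ℝ := ‖polyCurve p w‖ with ha
  have hk : Tendsto (fun ζ : ℂ => (-ζ / (1 - ζ) ^ 2) ^ s) l (𝓝 (κ : ℂ)) := by
    have : (κ : ℂ) = (-w / (1 - w) ^ 2) ^ s := by
      rw [neg_div_one_sub_sq_eq hw hw1, hκ, Complex.ofReal_pow]
    rw [this]
    refine Tendsto.mono_left ?_ hl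
    refine (Tendsto.div (Continuous.tendsto (by fun_prop) w) (Continuous.tendsto (by fun_prop) w)
      ?_).pow s
    exact pow_ne_zero _ (sub_ne_zero.2 hw1.symm)
  have hY := tendsto_polyCurve_inv_conj p hw l hl
  have hΦ : Tendsto (polyCurve p) l (𝓝 (polyCurve p w)) :=
    ((continuous_polyCurve p).tendsto w).mono_left hl
  set η' : ℝ := η / (κ * a + 1)
  have hη' : 0 < η' := by positivity
  have hlim := (Complex.continuous_re.tendsto _).comp (hk.mul (hY.inner hΦ (𝕜 := ℂ))) |>.sub
    ((hk.norm.mul hY.norm).mul_const (a + η'))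
  have hlt : -η < ((κ : ℂ) * inner ℂ (polyCurve p w) (polyCurve p w)).re
      - ‖(κ : ℂ)‖ * ‖polyCurve p w‖ * (a + η') := by
    rw [inner_self_eq_norm_sq_to_K, Complex.norm_real, Real.norm_of_nonneg hκ0, ← ha]
    have h1 : ((κ : ℂ) * ((a : ℝ) : ℂ) ^ 2).re = κ * a ^ 2 := by
      rw [← Complex.ofReal_pow, ← Complex.ofReal_mul, Complex.ofReal_re]
    have h2 : (κ * a + 1) * η' = η := mul_div_cancel₀ _ (by positivity)
    erw [h1]
    nlinarith
  filter_upwards [hlim.eventually (lt_mem_nhds hlt), hb η' hη',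
    hl (isOpen_ne.mem_nhds hw0)] with ζ h1 h2 (h3 : ζ ≠ 0)
  refine h1.le.trans ?_
  rw [pairingQuotient_eq_inner hp h3, inner_sub_right, mul_sub, Complex.sub_re]
  refine sub_le_sub le_rfl ((Complex.re_le_norm _).trans ?_)
  rw [norm_mul, mul_assoc]
  exact mul_le_mul_of_nonneg_left ((norm_inner_le_norm _ _).trans
    (mul_le_mul_of_nonneg_left h2 (norm_nonneg _))) (norm_nonneg _)

/-- If `⟪Φ, f⟫ = ⟪Φ, Φ⟫` and `|f| ≤ |Φ|` at a boundary point, then `f = Φ` there, by expanding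
`|f - Φ|²`. Inside the disc the first factor is `Φ` at the reflected point `1 / conj ζ`. -/
theorem eventually_norm_sub_polyCurve_le {w : ℂ} (hw : ‖w‖ = 1)
    (hb : ∀ η > 0, ∀ᶠ ζ in 𝓝[Metric.ball 0 1] w, ‖f ζ‖ ≤ ‖polyCurve p w‖ + η)
    (hin : ∀ᶠ ζ in 𝓝[Metric.ball 0 1] w,
      inner ℂ (polyCurve p ((starRingEnd ℂ) ζ)⁻¹) (polyCurve p ζ - f ζ) = 0)
    {C : ℝ} (hC : 0 < C) :
    ∀ᶠ ζ in 𝓝[Metric.ball 0 1] w, ‖f ζ - polyCurve p ζ‖ ≤ C := by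
  set l := 𝓝[Metric.ball (0 : ℂ) 1] w
  have hl : l ≤ 𝓝 w := nhdsWithin_le_nhds
  set a : ℝ := ‖polyCurve p w‖ with ha
  have hY := tendsto_polyCurve_inv_conj p hw l hl
  have hΦ : Tendsto (polyCurve p) l (𝓝 (polyCurve p w)) :=
    ((continuous_polyCurve p).tendsto w).mono_left hl
  obtain ⟨η, hη1, hη⟩ : ∃ η : ℝ, (a + η) ^ 2 - 2 * a ^ 2 + a ^ 2 < (C / 2) ^ 2 ∧ 0 < η := by
    have ht : Tendsto (fun η : ℝ => (a + η) ^ 2 - 2 * a ^ 2 + a ^ 2) (𝓝[>] 0) (𝓝 0) :=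
      (Continuous.tendsto' (by fun_prop) 0 _ (by ring)).mono_left nhdsWithin_le_nhds
    exact ((ht.eventually (gt_mem_nhds (by positivity))).and self_mem_nhdsWithin).exists
  have hlim : Tendsto (fun ζ => (a + η) ^ 2
      - 2 * (inner ℂ (polyCurve p ((starRingEnd ℂ) ζ)⁻¹) (polyCurve p ζ)).re
      + ‖polyCurve p ((starRingEnd ℂ) ζ)⁻¹‖ ^ 2) l (𝓝 ((a + η) ^ 2 - 2 * a ^ 2 + a ^ 2)) := by
    have h1 := (Complex.continuous_re.tendsto _).comp (hY.inner hΦ (𝕜 := ℂ))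
    have h2 : (inner ℂ (polyCurve p w) (polyCurve p w)).re = a ^ 2 :=
      inner_self_eq_norm_sq (𝕜 := ℂ) _
    rw [h2] at h1
    exact ((h1.const_mul 2).const_sub _).add (hY.norm.pow 2)
  have hsub : Tendsto (fun ζ => ‖polyCurve p ((starRingEnd ℂ) ζ)⁻¹ - polyCurve p ζ‖) l (𝓝 0) := by
    simpa using (hY.sub hΦ).norm
  filter_upwards [hlim.eventually (gt_mem_nhds hη1), hb η hη, hin,
    hsub.eventually (gt_mem_nhds (half_pos hC))] with ζ h1 h2 h3 h4
  have h5 : ‖f ζ - polyCurve p ((starRingEnd ℂ) ζ)⁻¹‖ ≤ C / 2 := by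
    refine (sq_le_sq₀ (norm_nonneg _) (half_pos hC).le).1 ?_
    rw [inner_sub_right, sub_eq_zero] at h3
    rw [h3] at h1
    rw [norm_sub_rev, norm_sub_sq (𝕜 := ℂ)]
    have := pow_le_pow_left₀ (norm_nonneg _) h2 2
    change _ - 2 * (inner ℂ _ _).re + _ ≤ _
    linarith
  calc ‖f ζ - polyCurve p ζ‖
      ≤ ‖f ζ - polyCurve p ((starRingEnd ℂ) ζ)⁻¹‖
        + ‖polyCurve p ((starRingEnd ℂ) ζ)⁻¹ - polyCurve p ζ‖ := norm_sub_le_norm_sub_add_norm_sub ..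
    _ ≤ C := by linarith

/-- The uniqueness theorem on the unit disc, where the bound on the boundary is global. -/
theorem eq_polyCurve_of_isLittleO (hp : ∀ j, (p j).natDegree ≤ s)
    (hf : DifferentiableOn ℂ f (Metric.ball 0 1))
    (hb : ∀ w : ℂ, ‖w‖ = 1 → w ≠ 1 → ∀ η > 0,
      ∀ᶠ ζ in 𝓝[Metric.ball 0 1] w, ‖f ζ‖ ≤ ‖polyCurve p w‖ + η)
    (ho : (fun ζ => f ζ - polyCurve p ζ)
      =o[𝓝[Metric.ball 0 1] 1] fun ζ => ‖ζ - 1‖ ^ (2 * s + 1))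
    {z : ℂ} (hz : z ∈ Metric.ball (0 : ℂ) 1) : f z = polyCurve p z := by
  have hH := differentiableOn_pairingQuotient (s := s) (p := p) hf
  have hHo := isLittleO_pairingQuotient ho
  have hre : ∀ z ∈ Metric.ball (0 : ℂ) 1, 0 ≤ (pairingQuotient s p f z).re := by
    intro z hz
    refine re_nonneg_of_eventually_neg_le_re hH (fun w hw η hη => ?_) hz
    rw [mem_sphere_zero_iff_norm] at hw
    rcases eq_or_ne w 1 with rfl | hw1
    · have h0 : Tendsto (pairingQuotient s p f) (𝓝[Metric.ball 0 1] 1) (𝓝 0) :=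
        hHo.trans_tendsto
          ((Continuous.tendsto' (by fun_prop) 1 _ (by simp)).mono_left nhdsWithin_le_nhds)
      have h1 := (Complex.continuous_re.tendsto _).comp h0
      exact (h1.eventually (lt_mem_nhds (by simpa using hη))).mono fun ζ h => le_of_lt h
    · exact eventually_neg_le_re_pairingQuotient hp hw hw1 (hb w hw hw1) hη
  have hzero : ∀ z ∈ Metric.ball (0 : ℂ) 1, pairingQuotient s p f z = 0 :=
    fun z hz => eq_zero_of_re_nonneg_of_isLittleO hH hre hHo hz
  have hsub : ‖f z - polyCurve p z‖ ≤ 0 := by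
    refine norm_le_of_eventually_norm_le (f := fun ζ => f ζ - polyCurve p ζ)
      (hf.sub (differentiable_polyCurve p).differentiableOn) (fun w hw C hC => ?_) hz
    rw [mem_sphere_zero_iff_norm] at hw
    rcases eq_or_ne w 1 with rfl | hw1
    · have h0 : Tendsto (fun ζ => f ζ - polyCurve p ζ) (𝓝[Metric.ball 0 1] 1) (𝓝 0) :=
        ho.trans_tendsto
          ((Continuous.tendsto' (by fun_prop) 1 _ (by simp)).mono_left nhdsWithin_le_nhds)
      have h1 := h0.norm
      rw [norm_zero] at h1
      exact (h1.eventually (gt_mem_nhds hC)).mono fun ζ h => le_of_lt h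
    · refine eventually_norm_sub_polyCurve_le hw (hb w hw hw1) ?_ hC
      have hw0 : w ≠ 0 := norm_ne_zero_iff.1 (by simp [hw])
      filter_upwards [self_mem_nhdsWithin, nhdsWithin_le_nhds (isOpen_ne.mem_nhds hw0)]
        with ζ hζ (hζ0 : ζ ≠ 0)
      have h := hzero ζ hζ
      rw [pairingQuotient_eq_inner hp hζ0] at h
      refine (mul_eq_zero.1 h).resolve_left (pow_ne_zero _ (div_ne_zero (neg_ne_zero.2 hζ0)
        (pow_ne_zero _ (sub_ne_zero.2 ?_))))
      rintro rfl
      simp at hζ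
  exact sub_eq_zero.1 (norm_le_zero_iff.1 hsub)

end Disc

/-! ### Uniqueness along complex lines -/

/-- The identity theorem on a convex open set, by restriction to complex lines. -/
theorem eqOn_zero_of_convex_of_eventuallyEq_zero {E G : Type*} [NormedAddCommGroup E]
    [NormedSpace ℂ E] [NormedAddCommGroup G] [NormedSpace ℂ G] [CompleteSpace G] {f : E → G}
    {U : Set E} (hUo : IsOpen U) (hUc : Convex ℝ U) (hf : DifferentiableOn ℂ f U) {z₀ : E}
    (h₀ : z₀ ∈ U) (hz₀ : f =ᶠ[𝓝 z₀] 0) : Set.EqOn f 0 U := by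
  intro z hz
  set γ : ℂ →ᵃ[ℂ] E := AffineMap.lineMap z₀ z
  have hγ : Continuous γ := AffineMap.lineMap_continuous
  have hγd : Differentiable ℂ γ := γ.differentiable
  have hS : IsPreconnected (γ ⁻¹' U) := by
    refine Convex.isPreconnected (s := γ ⁻¹' U) fun x hx y hy α β hα hβ hαβ => ?_
    have h : γ (α • x + β • y) = α • γ x + β • γ y := Convex.combo_affine_apply (f := AffineMap.mk
      γ (γ.linear.restrictScalars ℝ) fun p v => γ.map_vadd p v) hαβ
    rw [Set.mem_preimage, h]
    exact hUc hx hy hα hβ hαβ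
  have han : AnalyticOnNhd ℂ (f ∘ γ) (γ ⁻¹' U) :=
    (hf.comp hγd.differentiableOn fun _ h => h).analyticOnNhd (hUo.preimage hγ)
  have h0 : γ 0 = z₀ := AffineMap.lineMap_apply_zero _ _
  have h1 : γ 1 = z := AffineMap.lineMap_apply_one _ _
  have := han.eqOn_zero_of_preconnected_of_eventuallyEq_zero hS (z₀ := 0)
    (by rw [Set.mem_preimage, h0]; exact h₀) ((hγ.tendsto' 0 z₀ h0).eventually hz₀)
    (show (1 : ℂ) ∈ γ ⁻¹' U by rw [Set.mem_preimage, h1]; exact hz)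
  simpa [h1] using this

/-- A complex line through a unit vector `e` and a point `z` of the open ball is parametrized by
`ζ ↦ a + ζ • b`, where `a` is the point of the line nearest to the origin and `ζ = 1` gives `e`. It
meets the ball in `|ζ| < 1`, a disc of radius `‖b‖` that is small when the line is nearly tangent to
the sphere at `e`. -/
theorem exists_orthogonal_parametrization {E : Type*} [NormedAddCommGroup E]
    [InnerProductSpace ℂ E] {e z : E} (he : ‖e‖ = 1) (hz : ‖z‖ < 1) :
    ∃ a b : E, inner ℂ a b = 0 ∧ a + b = e ∧ b ≠ 0 ∧
      ‖b‖ * ‖z - e‖ = ‖inner ℂ (z - e) e‖ ∧ ∃ ζ : ℂ, z = a + ζ • b := by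
  set v := z - e with hv
  have hve : inner ℂ v e ≠ 0 := by
    intro h
    have h1 : ‖z‖ ^ 2 = ‖v‖ ^ 2 + ‖e‖ ^ 2 := by
      have := norm_add_sq_eq_norm_sq_add_norm_sq_of_inner_eq_zero v e h
      rw [hv, sub_add_cancel, ← hv] at this
      simpa [sq] using this
    nlinarith [norm_nonneg z, sq_nonneg ‖v‖]
  have hv0 : v ≠ 0 := by
    rintro h
    simp [h] at hve
  have hvn : (‖v‖ : ℂ) ≠ 0 := by simpa using hv0
  set c : ℂ := inner ℂ v e / (‖v‖ : ℂ) ^ 2 with hc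
  have hc0 : c ≠ 0 := div_ne_zero hve (pow_ne_zero _ hvn)
  refine ⟨e - c • v, c • v, ?_, sub_add_cancel _ _, smul_ne_zero hc0 hv0, ?_, (1 + c) / c, ?_⟩
  · rw [← inner_conj_symm, inner_smul_left, inner_sub_right, inner_smul_right,
      inner_self_eq_norm_sq_to_K]
    have : inner ℂ v e - c * (‖v‖ : ℂ) ^ 2 = 0 := by
      rw [hc, div_mul_cancel₀ _ (pow_ne_zero _ hvn), sub_self]
    erw [this]
    simp
  · have h : ‖v‖ ≠ 0 := by simpa using hv0
    rw [norm_smul, hc, norm_div, norm_pow, Complex.norm_real, norm_norm]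
    field_simp
  · rw [smul_smul, div_mul_cancel₀ _ hc0, add_smul, one_smul, hv]
    abel

theorem norm_add_smul_sq_of_inner_eq_zero {E : Type*} [NormedAddCommGroup E]
    [InnerProductSpace ℂ E] {a b : E} (hab : inner ℂ a b = 0) (h1 : ‖a + b‖ = 1) (ζ : ℂ) :
    ‖a + ζ • b‖ ^ 2 = 1 - (1 - ‖ζ‖ ^ 2) * ‖b‖ ^ 2 := by
  have h2 := norm_add_sq_eq_norm_sq_add_norm_sq_of_inner_eq_zero a b hab
  have h3 := norm_add_sq_eq_norm_sq_add_norm_sq_of_inner_eq_zero a (ζ • b)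
    (by rw [inner_smul_right, hab, mul_zero])
  rw [h1] at h2
  rw [sq, h3, norm_smul]
  linear_combination -h2

/-- The components of `polyMap P` restricted to the line `ζ ↦ a + ζ • b`. -/
noncomputable def linePoly {n m : ℕ} (P : Fin m → MvPolynomial (Fin n) ℂ)
    (a b : EuclideanSpace ℂ (Fin n)) (j : Fin m) : Polynomial ℂ :=
  MvPolynomial.aeval (fun i => Polynomial.C (a i) + Polynomial.X * Polynomial.C (b i)) (P j)

theorem natDegree_linePoly_le {n m s : ℕ} {P : Fin m → MvPolynomial (Fin n) ℂ}
    (hdeg : ∀ j, (P j).totalDegree ≤ s) (a b : EuclideanSpace ℂ (Fin n)) (j : Fin m) :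
    (linePoly P a b j).natDegree ≤ s := by
  have h := MvPolynomial.aeval_natDegree_le (n := 1) (P j) (hdeg j)
    (fun i => Polynomial.C (a i) + Polynomial.X * Polynomial.C (b i)) fun i =>
      Polynomial.natDegree_add_le_of_degree_le (by rw [Polynomial.natDegree_C]; exact zero_le_one)
        ((Polynomial.natDegree_mul_C_le _ _).trans Polynomial.natDegree_X_le)
  rwa [mul_one] at h

theorem polyCurve_linePoly {n m : ℕ} (P : Fin m → MvPolynomial (Fin n) ℂ)
    (a b : EuclideanSpace ℂ (Fin n)) (ζ : ℂ) :
    polyCurve (linePoly P a b) ζ = polyMap P (a + ζ • b) := by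
  ext j
  simp only [polyCurve, polyMap, linePoly]
  rw [← Polynomial.coe_evalRingHom, MvPolynomial.aeval_def, MvPolynomial.hom_eval₂,
    MvPolynomial.eval]
  congr 1
  · ext; simp
  · ext i; simp [mul_comm (b i)]

theorem differentiable_polyMap {n m : ℕ} (P : Fin m → MvPolynomial (Fin n) ℂ) :
    Differentiable ℂ (polyMap P) := by
  refine differentiable_euclidean.2 fun j => ?_
  simp only [polyMap, MvPolynomial.eval_eq]
  fun_prop

theorem BoundaryNormLE.eventually_norm_le {n m : ℕ}
    {F : EuclideanSpace ℂ (Fin n) → EuclideanSpace ℂ (Fin m)} {w : EuclideanSpace ℂ (Fin n)}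
    {c : ℝ} (h : BoundaryNormLE F w c) {c' : ℝ} (hc' : 0 < c') (hcc' : c < c') :
    ∀ᶠ z in 𝓝[unitBall n] w, ‖F z‖ ≤ c' := by
  have hlt : limsup (fun z => ‖F z‖ₑ) (𝓝[unitBall n] w) < ENNReal.ofReal c' :=
    lt_of_le_of_lt h ((ENNReal.ofReal_lt_ofReal_iff hc').2 hcc')
  filter_upwards [eventually_lt_of_limsup_lt hlt] with z hz
  rw [← ofReal_norm, ENNReal.ofReal_lt_ofReal_iff hc'] at hz
  exact hz.le

theorem basePoint_eq_single {n : ℕ} (hn : 0 < n) :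
    basePoint n = EuclideanSpace.single ⟨0, hn⟩ 1 := by
  ext i
  simp [basePoint, Fin.ext_iff]

theorem norm_basePoint {n : ℕ} (hn : 0 < n) : ‖basePoint n‖ = 1 := by
  rw [basePoint_eq_single hn]
  simp

/-- Uniqueness on the lines through `𝟏` whose intersection with the ball has diameter less than `ε`,
so that the boundary bound holds on the whole circle in which they meet the sphere. -/
theorem eq_polyMap_of_norm_inner_lt {n m s : ℕ} (hn : 0 < n)
    {P : Fin m → MvPolynomial (Fin n) ℂ} (hdeg : ∀ j, (P j).totalDegree ≤ s)
    {F : EuclideanSpace ℂ (Fin n) → EuclideanSpace ℂ (Fin m)}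
    (hF : DifferentiableOn ℂ F (unitBall n)) {ε : ℝ}
    (hbd : ∀ w ∈ Metric.sphere (0 : EuclideanSpace ℂ (Fin n)) 1 ∩ Metric.ball (basePoint n) ε,
      BoundaryNormLE F w ‖polyMap P w‖)
    (hasymp : (fun z => F z - polyMap P z)
      =o[𝓝[unitBall n] (basePoint n)] fun z => ‖z - basePoint n‖ ^ (2 * s + 1))
    {z : EuclideanSpace ℂ (Fin n)} (hz : z ∈ unitBall n)
    (hzε : ‖inner ℂ (z - basePoint n) (basePoint n)‖ < ε / 2 * ‖z - basePoint n‖) :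
    F z = polyMap P z := by
  rw [mem_ball_zero_iff] at hz
  obtain ⟨a, b, hab, hsum, hb0, hb, ζ₀, hζ₀⟩ :=
    exists_orthogonal_parametrization (norm_basePoint hn) hz
  have hbε : ‖b‖ < ε / 2 := by
    rw [← hb] at hzε
    exact lt_of_mul_lt_mul_right hzε (norm_nonneg _)
  have hbpos : 0 < ‖b‖ := norm_pos_iff.2 hb0
  have hnorm := norm_add_smul_sq_of_inner_eq_zero hab (hsum ▸ norm_basePoint hn)
  have hball : ∀ ζ : ℂ, a + ζ • b ∈ unitBall n ↔ ζ ∈ Metric.ball (0 : ℂ) 1 := by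
    intro ζ
    rw [mem_ball_zero_iff, mem_ball_zero_iff, ← sq_lt_one_iff₀ (norm_nonneg _), hnorm,
      ← sq_lt_one_iff₀ (norm_nonneg ζ), sub_lt_self_iff, mul_pos_iff_of_pos_right (by positivity),
      sub_pos]
  have hγ : Continuous fun ζ : ℂ => a + ζ • b := by fun_prop
  have hγw : ∀ w : ℂ, Tendsto (fun ζ : ℂ => a + ζ • b) (𝓝[Metric.ball 0 1] w)
      (𝓝[unitBall n] (a + w • b)) := fun w =>
    (hγ.tendsto w).inf (tendsto_principal_principal.2 fun ζ hζ => (hball ζ).2 hζ)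
  have hdist : ∀ ζ : ℂ, a + ζ • b - basePoint n = (ζ - 1) • b := by
    intro ζ
    rw [← hsum, sub_smul, one_smul]
    abel
  have key := eq_polyCurve_of_isLittleO (s := s) (p := linePoly P a b)
    (f := fun ζ => F (a + ζ • b)) (natDegree_linePoly_le hdeg a b)
    (hF.comp (by fun_prop) fun ζ hζ => (hball ζ).2 hζ) ?_ ?_ (z := ζ₀)
    ((hball ζ₀).1 (by rw [← hζ₀]; exact mem_ball_zero_iff.2 hz))
  · simpa only [polyCurve_linePoly, ← hζ₀] using key
  · intro w hw _ η hη
    rw [polyCurve_linePoly]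
    refine (hγw w).eventually ((hbd (a + w • b) ⟨?_, ?_⟩).eventually_norm_le (by positivity)
      (lt_add_of_pos_right _ hη))
    · have h := hnorm w
      rw [hw] at h
      rw [mem_sphere_zero_iff_norm, ← sq_eq_sq₀ (norm_nonneg _) zero_le_one, h]
      ring
    · rw [mem_ball_iff_norm, hdist, norm_smul]
      have : ‖w - 1‖ ≤ 2 := (norm_sub_le _ _).trans (by rw [hw, norm_one]; norm_num)
      nlinarith
  · simp only [polyCurve_linePoly]
    have h1 := hγw 1
    rw [one_smul, hsum] at h1
    refine (hasymp.comp_tendsto h1).trans_isBigO (IsBigO.of_bound (‖b‖ ^ (2 * s + 1))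
      (Eventually.of_forall fun ζ => ?_))
    simp only [Function.comp_apply, hdist, norm_smul, norm_mul, norm_pow, norm_norm]
    rw [mul_pow, mul_comm]

/-- In dimension at least two there are nearly tangent directions at `𝟏` that enter the ball. -/
theorem exists_mem_unitBall_norm_inner_lt {n : ℕ} (hn : 2 ≤ n) {ε : ℝ} (hε : 0 < ε) :
    ∃ z ∈ unitBall n,
      ‖inner ℂ (z - basePoint n) (basePoint n)‖ < ε * ‖z - basePoint n‖ := by
  have hn0 : 0 < n := by omega
  obtain ⟨t, ht0, ht⟩ := exists_between (lt_min hε one_pos)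
  obtain ⟨htε, ht1⟩ := lt_min_iff.1 ht
  set e := basePoint n with he
  set e' : EuclideanSpace ℂ (Fin n) := EuclideanSpace.single ⟨1, hn⟩ 1
  have he1 : ‖e‖ = 1 := norm_basePoint hn0
  have he'1 : ‖e'‖ = 1 := by simp [e']
  have hee' : inner ℂ e e' = 0 := by
    rw [he, basePoint_eq_single hn0]
    simp [e', EuclideanSpace.inner_single_left]
  have hnorm : ∀ x y : ℝ, ‖(x : ℂ) • e + (y : ℂ) • e'‖ ^ 2 = x ^ 2 + y ^ 2 := by
    intro x y
    have h := norm_add_sq_eq_norm_sq_add_norm_sq_of_inner_eq_zero ((x : ℂ) • e) ((y : ℂ) • e')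
      (by rw [inner_smul_left, inner_smul_right, hee', mul_zero, mul_zero])
    rw [sq, h, norm_smul, norm_smul, he1, he'1, Complex.norm_real, Complex.norm_real, mul_one,
      mul_one, Real.norm_eq_abs, Real.norm_eq_abs, abs_mul_abs_self, abs_mul_abs_self]
    ring
  -- The point lies at depth `t ^ 2` below `𝟏` and at tangential distance `t` from it.
  refine ⟨((1 - t ^ 2 : ℝ) : ℂ) • e + (t : ℂ) • e', ?_, ?_⟩
  · rw [mem_ball_zero_iff, ← sq_lt_one_iff₀ (norm_nonneg _), hnorm]
    have : t ^ 2 < 1 := by nlinarith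
    nlinarith [mul_pos ht0 ht0, mul_pos (mul_pos ht0 ht0) (sub_pos.2 this)]
  · have hsub : ((1 - t ^ 2 : ℝ) : ℂ) • e + (t : ℂ) • e' - e
        = ((-t ^ 2 : ℝ) : ℂ) • e + (t : ℂ) • e' := by
      push_cast
      module
    rw [hsub]
    have hle : t ≤ ‖((-t ^ 2 : ℝ) : ℂ) • e + (t : ℂ) • e'‖ := by
      rw [← sq_le_sq₀ ht0.le (norm_nonneg _), hnorm]
      nlinarith [sq_nonneg (-t ^ 2)]
    have hin : ‖inner ℂ (((-t ^ 2 : ℝ) : ℂ) • e + (t : ℂ) • e') e‖ = t ^ 2 := by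
      rw [inner_add_left, inner_smul_left, inner_smul_left, inner_eq_zero_symm.1 hee',
        inner_self_eq_norm_sq_to_K, he1]
      simp
    rw [hin]
    nlinarith

theorem theorem2 (n m s : ℕ) (hn : 2 ≤ n)
    (P : Fin m → MvPolynomial (Fin n) ℂ)
    (hdeg : ∀ j, (P j).totalDegree ≤ s)
    (hne : ∀ j, polyMap P (basePoint n) j ≠ 0)
    (F : EuclideanSpace ℂ (Fin n) → EuclideanSpace ℂ (Fin m))
    (hF : DifferentiableOn ℂ F (unitBall n))
    (ε : ℝ) (hε : 0 < ε)
    (hbd : ∀ w ∈ Metric.sphere (0 : EuclideanSpace ℂ (Fin n)) 1 ∩ Metric.ball (basePoint n) ε,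
      BoundaryNormLE F w ‖polyMap P w‖)
    (hasymp : (fun z => F z - polyMap P z)
      =o[𝓝[unitBall n] (basePoint n)] fun z => ‖z - basePoint n‖ ^ (2 * s + 1)) :
    ∀ z ∈ unitBall n, F z = polyMap P z := by
  obtain ⟨z₀, hz₀, hz₀ε⟩ := exists_mem_unitBall_norm_inner_lt hn (half_pos hε)
  have hev : (fun z => F z - polyMap P z) =ᶠ[𝓝 z₀] 0 := by
    have hopen : IsOpen {z : EuclideanSpace ℂ (Fin n) |
        ‖inner ℂ (z - basePoint n) (basePoint n)‖ < ε / 2 * ‖z - basePoint n‖} :=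
      isOpen_lt (by fun_prop) (by fun_prop)
    filter_upwards [Metric.isOpen_ball.mem_nhds hz₀, hopen.mem_nhds hz₀ε] with z hz hzε
    exact sub_eq_zero.2 (eq_polyMap_of_norm_inner_lt (by omega) hdeg hF hbd hasymp hz hzε)
  intro z hz
  exact sub_eq_zero.1 (eqOn_zero_of_convex_of_eventuallyEq_zero Metric.isOpen_ball
    (convex_ball 0 1) (hF.sub (differentiable_polyMap P).differentiableOn) hz₀ hev hz)
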